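/- A public scenario $S_p=(I_A,M,O)$ consists of a set of agents $I_A=\{1,\dots,N\}$, measurement sets $M_i=\{1,\dots,m_i\}$ for $i\in I_A$, and outcome sets $O_{x_i}=\{1,\dots,o_{x_i}\}$ for every $i\in I_A$ and $x_i\in M_i$, all of these sets being finite of cardinality at least $2$. Put $M=\prod_i M_i$ and $O_{\vec x}=\prod_i O_{x_i}$ for $\vec x\in M$. A behaviour $\wp$ assigns to every $\vec x\in M$ a probability distribution $\wp(\cdot|\vec x)$ on $O_{\vec x}$; for $V\subseteq I_A$, $\wp(\vec a_V|\vec x)$ denotes its marginal on the agents in $V$. The Bell set $\mathcal B(S_p)$ is the set of behaviours of the form $\wp(\vec a|\vec x)=\int_\Lambda \prod_{i=1}^N P(a_i|x_i,\lambda)\,d\mu(\lambda)$, where $(\Lambda,\mu)$ is a probability space and, for each $\lambda$, $i$ and $x_i$, $P(\cdot|x_i,\lambda)$ is a probability distribution on $O_{x_i}$ depending measurably on $\lambda$. For a set of friends $I_F\subseteq I_A$, let $F_{\vec x}=\{i\in I_F : x_i=1\}$ and $J_{\vec x}=I_A\setminus F_{\vec x}$. The Local Friendliness set $\mathcal{LF}(S_p,I_F)$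 is the set of behaviours of the form $$\wp(\vec a|\vec x)=\sum_{\vec c}\ \prod_{i\in F_{\vec x}}\delta_{a_i,c_i}\cdot P(\vec a_{J_{\vec x}}|\vec x_{J_{\vec x}},\vec c)\,P(\vec c),$$ where $\vec c=(c_i)_{i\in I_F}$ ranges over $\prod_{i\in I_F}O_{x_i=1}$, $P(\vec c)$ is a probability distribution, and for each $\vec c$ the family $P(\vec a|\vec x,\vec c)$ is a behaviour satisfying Local Agency: for every $V\subseteq I_A$, the marginal $P(\vec a_V|\vec x,\vec c)$ depends on $\vec x$ only through $\vec x_V$, and is then written $P(\vec a_V|\vec x_V,\vec c)$. Theorem. Let $S=(S_p,I_F)$ and $S'=(S_p,I_F')$ be two scenarios with the same public scenario $S_p$ and with $I_F\not\subseteq I_F'$ and $I_F'\not\subseteq I_F$. Then exactly one of the following three conditions holds: 1. $|I_F|=|I_F'|=N-1$, $|M_i|=2$ for all $i\in I_A$, and $\mathcal{LF}(S)=\mathcal{LF}(S')=\mathcal B(S_p)$; 2. $\mathcal B(S_p)=\mathcal{LF}(S)\subsetneq\mathcal{LF}(S')$ or $\mathcal B(S_p)=\mathcal{LF}(S')\subsetneq\mathcal{LF}(S)$;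 3. $\mathcal{LF}(S)\not\subseteq\mathcal{LF}(S')$ and $\mathcal{LF}(S')\not\subseteq\mathcal{LF}(S)$. -/

import Mathlib

/-- A public scenario `S_p = (I_A, M, O)`: agents `I_A = Fin N`, measurements `M_i = Fin (m i)`,
and outcomes `O_{x_i} = Fin (o i x_i)` of measurement `x_i`, all of cardinality at least two.
Labels are counted from `0` instead of `1`. -/
structure PublicScenario where
  N : ℕ
  m : Fin N → ℕ
  o : (i : Fin N) → Fin (m i) → ℕ
  two_le_N : 2 ≤ N
  two_le_m : ∀ i, 2 ≤ m i
  two_le_o : ∀ i s, 2 ≤ o i s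

namespace PublicScenario

/-- Input strings `x ∈ M = M_1 × ⋯ × M_N`. -/
abbrev Inputs (S : PublicScenario) : Type := (i : Fin S.N) → Fin (S.m i)

/-- Outcome strings `a ∈ O_x = O_{x_1} × ⋯ × O_{x_N}` of the input string `x`. -/
abbrev Outcomes (S : PublicScenario) (x : S.Inputs) : Type := (i : Fin S.N) → Fin (S.o i (x i))

/-- Families of real numbers `p(a|x)`, indexed by the input strings and their outcome strings. -/
abbrev Table (S : PublicScenario) : Type := (x : S.Inputs) → S.Outcomes x → ℝ

/-- A behaviour: a probability distribution over the outcome strings for every input string. -/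
def IsBehaviour (S : PublicScenario) (p : S.Table) : Prop :=
  ∀ x, (∀ a, 0 ≤ p x a) ∧ ∑ a, p x a = 1

/-- The query measurement of agent `i` (the first label). -/
def query (S : PublicScenario) (i : Fin S.N) : Fin (S.m i) :=
  ⟨0, lt_of_lt_of_le Nat.zero_lt_two (S.two_le_m i)⟩

/-- The marginal `p(a_V|x)`: the sum of `p(b|x)` over all `b` that agree with `a` on `V`. -/
noncomputable def marginal (S : PublicScenario) (p : S.Table) (V : Finset (Fin S.N))
    (x : S.Inputs) (a : S.Outcomes x) : ℝ :=
  ∑ b : S.Outcomes x with ∀ i ∈ V, b i = a i, p x b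

/-- Local Agency: for every set `V` of agents, `p(a_V|x) = p(a_V|x_V)`, that is, the marginal on
`V` is the same for any two input strings with the same substring on `V`. -/
def LocalAgency (S : PublicScenario) (p : S.Table) : Prop :=
  ∀ (V : Finset (Fin S.N)) (x x' : S.Inputs) (a : S.Outcomes x) (a' : S.Outcomes x'),
    (∀ i ∈ V, x i = x' i ∧ (a i : ℕ) = (a' i : ℕ)) →
      S.marginal p V x a = S.marginal p V x' a'

/-- Strings `c = (c_i)_{i ∈ I_F}` of outcomes of the friends, `c_i` being a possible outcome of
the query measurement of agent `i`. -/
abbrev FriendOutcomes (S : PublicScenario) (IF : Finset (Fin S.N)) : Type :=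
  (i : {i // i ∈ IF}) → Fin (S.o i (S.query i))

/-- `F_x`: the agents with a friend who choose the query measurement. -/
def queried (S : PublicScenario) (IF : Finset (Fin S.N)) (x : S.Inputs) : Finset (Fin S.N) :=
  {i ∈ IF | x i = S.query i}

/-- The product over `i ∈ F_x` of the Kronecker deltas `δ_{a_i, c_i}`. -/
noncomputable def deltas (S : PublicScenario) (IF : Finset (Fin S.N)) (x : S.Inputs)
    (a : S.Outcomes x) (c : S.FriendOutcomes IF) : ℝ :=
  ∏ i : {i // i ∈ S.queried IF x},
    if (a i : ℕ) = (c ⟨i, Finset.mem_of_mem_filter _ i.2⟩ : ℕ) then 1 else 0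

/-- The set `LF(S_p, I_F)` of Local Friendliness behaviours: those with a decomposition
`p(a|x) = ∑_c (∏_{i ∈ F_x} δ_{a_i,c_i}) P(a_{J_x}|x_{J_x}, c) P(c)`, where `J_x = I_A \ F_x`, `P(c)`
is a probability distribution and the `P(⬝|⬝, c)` are distributions satisfying Local Agency. -/
def LF (S : PublicScenario) (IF : Finset (Fin S.N)) : Set S.Table :=
  {p | S.IsBehaviour p ∧
    ∃ (w : S.FriendOutcomes IF → ℝ) (P : S.FriendOutcomes IF → S.Table),
      (∀ c, 0 ≤ w c) ∧ ∑ c, w c = 1 ∧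
      (∀ c, S.IsBehaviour (P c) ∧ S.LocalAgency (P c)) ∧
      ∀ x a, p x a =
        ∑ c, S.deltas IF x a c * S.marginal (P c) (Finset.univ \ S.queried IF x) x a * w c}

/-- The set `B(S_p)` of Bell-local behaviours: those with a local hidden variable model
`p(a|x) = ∫ ∏_i P(a_i|x_i, l) dμ(l)` over a probability space `(Λ, μ)`. -/
def Bell (S : PublicScenario) : Set S.Table :=
  {p | S.IsBehaviour p ∧
    ∃ (Λ : Type) (_ : MeasurableSpace Λ) (μ : MeasureTheory.Measure Λ)
      (P : (i : Fin S.N) → (s : Fin (S.m i)) → Fin (S.o i s) → Λ → ℝ),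
      MeasureTheory.IsProbabilityMeasure μ ∧
      (∀ i s k, Measurable (P i s k)) ∧
      (∀ i s l, (∀ k, 0 ≤ P i s k l) ∧ ∑ k, P i s k l = 1) ∧
      ∀ x a, p x a = ∫ l, ∏ i, P i (x i) (a i) l ∂μ}

end PublicScenario

/-- Exactly one of three propositions holds. -/
def ExactlyOne (A B C : Prop) : Prop :=
  (A ∧ ¬ B ∧ ¬ C) ∨ (¬ A ∧ B ∧ ¬ C) ∨ (¬ A ∧ ¬ B ∧ C)

namespace PublicScenario

/-! Given the friends' outcomes `c`, a Local Friendliness behaviour is a Local Agency table in which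
every agent with a friend has a predetermined answer to the query. The theorem follows from one
implication, used in both directions: if `i ∈ IF' \ IF` and `LF IF ⊆ LF IF'`, then `LF IF = Bell`.

Suppose some `j ≠ i` has no friend in `IF` or has at least three measurements. Then `j` has two
measurements that the friends in `IF` do not fix, and a Popescu–Rohrlich type box shared by `i` and
`j` lies in `LF IF` (`box_mem_LF`). A friend of `i` would make one of the two measurements in the
box deterministic for `i`, which contradicts its correlations (`box_notMem_LF`). Hence every `j ≠ i`
has a friend in `IF` and exactly two measurements (`eq_two_of_LF_subset`).

In that case, given `c`, each agent other than `i` has only one measurement left to randomize. The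
joint outcome of these measurements, together with `c`, is a hidden variable, and `i` answers by
conditional probabilities (`LF_subset_Bell`). As `Bell` is always contained in `LF`, the three
conditions record which of the two inclusions hold. -/

/-! ### Marginals and Local Agency -/

/-- The outcome string with values `f i`, where values out of range are replaced by `0`. -/
def ofValues (S : PublicScenario) (x : S.Inputs) (f : Fin S.N → ℕ) : S.Outcomes x :=
  fun i => ⟨if f i < S.o i (x i) then f i else 0, by
    have := S.two_le_o i (x i)
    split_ifs <;> omega⟩

theorem ofValues_val (S : PublicScenario) (x : S.Inputs) (f : Fin S.N → ℕ) (i : Fin S.N)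
    (h : f i < S.o i (x i)) : (S.ofValues x f i : ℕ) = f i := by
  simp [ofValues, h]

theorem ofValues_val_of_eq (S : PublicScenario) {x x' : S.Inputs} (a : S.Outcomes x)
    (i : Fin S.N) (h : x i = x' i) : (S.ofValues x' (fun i => (a i : ℕ)) i : ℕ) = a i := by
  apply ofValues_val
  rw [← h]
  exact (a i).2

theorem outcomes_ext {S : PublicScenario} {x : S.Inputs} {a b : S.Outcomes x}
    (h : ∀ i, (a i : ℕ) = b i) : a = b :=
  funext fun i => Fin.ext (h i)

theorem marginal_eq_sum_ite (S : PublicScenario) (p : S.Table) (V : Finset (Fin S.N))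
    (x : S.Inputs) (a : S.Outcomes x) :
    S.marginal p V x a = ∑ b : S.Outcomes x, if ∀ i ∈ V, b i = a i then p x b else 0 := by
  rw [marginal, Finset.sum_filter]

theorem marginal_nonneg (S : PublicScenario) {p : S.Table} (hp : ∀ x a, 0 ≤ p x a)
    (V : Finset (Fin S.N)) (x : S.Inputs) (a : S.Outcomes x) : 0 ≤ S.marginal p V x a :=
  Finset.sum_nonneg fun _ _ => hp _ _

theorem le_marginal (S : PublicScenario) {p : S.Table} (hp : ∀ x a, 0 ≤ p x a)
    (V : Finset (Fin S.N)) {x : S.Inputs} {a b : S.Outcomes x} (h : ∀ i ∈ V, b i = a i) :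
    p x b ≤ S.marginal p V x a :=
  Finset.single_le_sum (f := fun b => p x b) (fun _ _ => hp _ _) (by simpa using h)

theorem marginal_sum (S : PublicScenario) {ι : Type*} (s : Finset ι) (R : ι → S.Table)
    (V : Finset (Fin S.N)) (x : S.Inputs) (a : S.Outcomes x) :
    S.marginal (fun x a => ∑ k ∈ s, R k x a) V x a = ∑ k ∈ s, S.marginal (R k) V x a := by
  simp only [marginal]
  exact Finset.sum_comm

theorem marginal_mul_left (S : PublicScenario) (r : ℝ) (p : S.Table)
    (V : Finset (Fin S.N)) (x : S.Inputs) (a : S.Outcomes x) :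
    S.marginal (fun x a => r * p x a) V x a = r * S.marginal p V x a := by
  simp only [marginal, Finset.mul_sum]

theorem LocalAgency.sum {S : PublicScenario} {ι : Type*} {s : Finset ι} {R : ι → S.Table}
    (h : ∀ k ∈ s, S.LocalAgency (R k)) : S.LocalAgency (fun x a => ∑ k ∈ s, R k x a) := by
  intro V x x' a a' hV
  simp only [marginal_sum]
  exact Finset.sum_congr rfl fun k hk => h k hk V x x' a a' hV

theorem LocalAgency.mul_left {S : PublicScenario} {p : S.Table} (h : S.LocalAgency p) (r : ℝ) :
    S.LocalAgency (fun x a => r * p x a) := by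
  intro V x x' a a' hV
  simp only [marginal_mul_left]
  rw [h V x x' a a' hV]

theorem LocalAgency.sum_eq {S : PublicScenario} {p : S.Table} (h : S.LocalAgency p)
    (x x' : S.Inputs) : ∑ a, p x a = ∑ a, p x' a := by
  simpa [marginal] using h ∅ x x' (S.ofValues x 0) (S.ofValues x' 0) (by simp)

/-- Possibilistic Local Agency. -/
theorem LocalAgency.exists_ne_zero {S : PublicScenario} {p : S.Table} (h : S.LocalAgency p)
    (hp : ∀ x a, 0 ≤ p x a) (V : Finset (Fin S.N)) {x : S.Inputs} (x' : S.Inputs)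
    {a : S.Outcomes x} (hx : ∀ i ∈ V, x i = x' i) (ha : p x a ≠ 0) :
    ∃ a' : S.Outcomes x', p x' a' ≠ 0 ∧ ∀ i ∈ V, (a' i : ℕ) = a i := by
  have h1 : 0 < S.marginal p V x a :=
    ((hp x a).lt_of_ne' ha).trans_le (S.le_marginal hp V fun _ _ => rfl)
  have h2 : ∀ i ∈ V, (S.ofValues x' (fun i => (a i : ℕ)) i : ℕ) = a i :=
    fun i hi => S.ofValues_val_of_eq a i (hx i hi)
  rw [h V x x' a (S.ofValues x' fun i => (a i : ℕ)) fun i hi => ⟨hx i hi, (h2 i hi).symm⟩] at h1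
  obtain ⟨b, hb, hb0⟩ := Finset.exists_ne_zero_of_sum_ne_zero h1.ne'
  refine ⟨b, hb0, fun i hi => ?_⟩
  rw [← h2 i hi, (Finset.mem_filter.1 hb).2 i hi]

/-! ### Deterministic behaviours -/

/-- The deterministic behaviour in which agent `i` answers measurement `s` with `d i s`. -/
def deterministic (S : PublicScenario) (d : (i : Fin S.N) → (s : Fin (S.m i)) → Fin (S.o i s)) :
    S.Table :=
  fun x a => if ∀ i, a i = d i (x i) then 1 else 0

theorem deterministic_nonneg (S : PublicScenario)
    (d : (i : Fin S.N) → (s : Fin (S.m i)) → Fin (S.o i s)) (x : S.Inputs) (a : S.Outcomes x) :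
    0 ≤ S.deterministic d x a := by
  rw [deterministic]
  split_ifs <;> simp

theorem marginal_deterministic (S : PublicScenario)
    (d : (i : Fin S.N) → (s : Fin (S.m i)) → Fin (S.o i s)) (V : Finset (Fin S.N))
    (x : S.Inputs) (a : S.Outcomes x) :
    S.marginal (S.deterministic d) V x a = if ∀ i ∈ V, a i = d i (x i) then 1 else 0 := by
  have h : ∀ b : S.Outcomes x, (∀ i, b i = d i (x i)) ↔ b = fun i => d i (x i) :=
    fun b => funext_iff.symm
  simp only [marginal_eq_sum_ite, deterministic, h, ← ite_and]
  rw [Finset.sum_eq_single (fun i => d i (x i))]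
  · simp [eq_comm]
  · intro b _ hb
    simp [hb]
  · simp

theorem deterministic_isBehaviour (S : PublicScenario)
    (d : (i : Fin S.N) → (s : Fin (S.m i)) → Fin (S.o i s)) :
    S.IsBehaviour (S.deterministic d) := by
  refine fun x => ⟨S.deterministic_nonneg d x, ?_⟩
  simpa [marginal] using S.marginal_deterministic d ∅ x (S.ofValues x 0)

theorem deterministic_localAgency (S : PublicScenario)
    (d : (i : Fin S.N) → (s : Fin (S.m i)) → Fin (S.o i s)) :
    S.LocalAgency (S.deterministic d) := by
  intro V x x' a a' h
  rw [marginal_deterministic, marginal_deterministic]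
  refine if_congr (forall₂_congr fun i hi => ?_) rfl rfl
  obtain ⟨h1, h2⟩ := h i hi
  rw [Fin.ext_iff, Fin.ext_iff, h2, h1]

/-! ### Local Friendliness as a sum of subnormalized tables -/

/-- The outcomes of the queried agents with a friend are those of their friends. -/
def Consistent (S : PublicScenario) (IF : Finset (Fin S.N)) (c : S.FriendOutcomes IF)
    (V : Finset (Fin S.N)) (x : S.Inputs) (a : S.Outcomes x) : Prop :=
  ∀ i ∈ V, ∀ hi : i ∈ IF, x i = S.query i → (a i : ℕ) = c ⟨i, hi⟩

open Classical in
theorem deltas_eq (S : PublicScenario) (IF : Finset (Fin S.N)) (x : S.Inputs)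
    (a : S.Outcomes x) (c : S.FriendOutcomes IF) :
    S.deltas IF x a c = if S.Consistent IF c Finset.univ x a then 1 else 0 := by
  rw [deltas, Finset.prod_ite_zero]
  simp only [Finset.prod_const_one]
  refine if_congr ?_ rfl rfl
  constructor
  · intro h i _ hi hx
    exact h ⟨i, by simp [queried, hi, hx]⟩ (Finset.mem_univ _)
  · rintro h ⟨i, hi⟩ _
    exact h i (Finset.mem_univ _) _ (Finset.mem_filter.1 hi).2

/-- The outcome string `a` with the outcomes of the queried agents replaced by those of their
friends. -/
def override (S : PublicScenario) (IF : Finset (Fin S.N)) (c : S.FriendOutcomes IF)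
    (x : S.Inputs) (a : S.Outcomes x) : S.Outcomes x :=
  fun i => if h : i ∈ IF ∧ x i = S.query i then
    Fin.cast (congrArg (S.o i) h.2.symm) (c ⟨i, h.1⟩) else a i

theorem consistent_and_eq_iff (S : PublicScenario) (IF : Finset (Fin S.N))
    (c : S.FriendOutcomes IF) (x : S.Inputs) (a b : S.Outcomes x) :
    (S.Consistent IF c Finset.univ x b ∧ ∀ i ∈ Finset.univ \ S.queried IF x, a i = b i) ↔
      b = S.override IF c x a := by
  constructor
  · rintro ⟨h1, h2⟩
    refine outcomes_ext fun i => ?_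
    by_cases h : i ∈ IF ∧ x i = S.query i
    · simpa [override, h] using h1 i (Finset.mem_univ _) h.1 h.2
    · simp [override, h, h2 i (by simpa [queried] using h)]
  · rintro rfl
    refine ⟨fun i _ hi hx => by simp [override, hi, hx], fun i hi => ?_⟩
    have : ¬ (i ∈ IF ∧ x i = S.query i) := by simpa [queried] using hi
    simp [override, this]

theorem override_eq_iff (S : PublicScenario) (IF : Finset (Fin S.N))
    (c : S.FriendOutcomes IF) (V : Finset (Fin S.N)) (x : S.Inputs) (a e : S.Outcomes x) :
    (∀ i ∈ V, S.override IF c x e i = a i) ↔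
      S.Consistent IF c V x a ∧ ∀ i ∈ V \ S.queried IF x, e i = a i := by
  constructor
  · intro h
    refine ⟨fun i hV hi hx => ?_, fun i hi => ?_⟩
    · rw [← h i hV]
      simp [override, hi, hx]
    · rw [Finset.mem_sdiff] at hi
      rw [← h i hi.1]
      have : ¬ (i ∈ IF ∧ x i = S.query i) := by simpa [queried] using hi.2
      simp [override, this]
  · rintro ⟨h1, h2⟩ i hV
    by_cases h : i ∈ IF ∧ x i = S.query i
    · apply Fin.ext
      rw [h1 i hV h.1 h.2]
      simp [override, h]
    · simp [override, h, h2 i (by simpa [queried, hV] using h)]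

open Classical in
-- A term of the Local Friendliness decomposition is the push-forward of `p` under `override`, so
-- its marginal sums `p` over the strings whose override agrees with `a` on `V`.
theorem marginal_deltas_mul_marginal (S : PublicScenario) (IF : Finset (Fin S.N))
    (c : S.FriendOutcomes IF) (p : S.Table) (V : Finset (Fin S.N)) (x : S.Inputs)
    (a : S.Outcomes x) :
    S.marginal (fun x a => S.deltas IF x a c * S.marginal p (Finset.univ \ S.queried IF x) x a)
      V x a = if S.Consistent IF c V x a then S.marginal p (V \ S.queried IF x) x a else 0 := by
  have key : ∀ b : S.Outcomes x, (if ∀ i ∈ V, b i = a i then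
      S.deltas IF x b c * S.marginal p (Finset.univ \ S.queried IF x) x b else 0) =
      ∑ e : S.Outcomes x, if b = S.override IF c x e then
        (if ∀ i ∈ V, b i = a i then p x e else 0) else 0 := by
    intro b
    simp only [← consistent_and_eq_iff, deltas_eq, marginal_eq_sum_ite]
    split_ifs with h1 h2
    · simp [h2]
    · simp [h2]
    · simp
  rw [marginal_eq_sum_ite]
  simp only [key]
  rw [Finset.sum_comm]
  simp only [Finset.sum_ite_eq', Finset.mem_univ, if_true, override_eq_iff]
  by_cases h : S.Consistent IF c V x a
  · simp [h, marginal_eq_sum_ite]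
  · simp [h]

theorem deltas_mul_marginal_localAgency (S : PublicScenario) (IF : Finset (Fin S.N))
    (c : S.FriendOutcomes IF) {p : S.Table} (hp : S.LocalAgency p) :
    S.LocalAgency
      (fun x a => S.deltas IF x a c * S.marginal p (Finset.univ \ S.queried IF x) x a) := by
  classical
  intro V x x' a a' h
  have hV : V \ S.queried IF x = V \ S.queried IF x' := by
    ext i
    simp only [Finset.mem_sdiff, queried, Finset.mem_filter]
    exact and_congr_right fun hi => by rw [(h i hi).1]
  rw [marginal_deltas_mul_marginal, marginal_deltas_mul_marginal]
  refine if_congr ?_ ?_ rfl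
  · exact forall₂_congr fun i hi => by rw [(h i hi).2, (h i hi).1]
  · rw [← hV]
    exact hp _ x x' a a' fun i hi => h i (Finset.mem_sdiff.1 hi).1

theorem deltas_mul_marginal_of_consistent (S : PublicScenario) (IF : Finset (Fin S.N))
    (c : S.FriendOutcomes IF) {p : S.Table}
    (hp : ∀ x a, p x a ≠ 0 → S.Consistent IF c Finset.univ x a) (x : S.Inputs)
    (a : S.Outcomes x) :
    S.deltas IF x a c * S.marginal p (Finset.univ \ S.queried IF x) x a = p x a := by
  classical
  rw [deltas_eq]
  split_ifs with h
  · rw [one_mul, marginal, Finset.sum_eq_single a]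
    · intro b hb hba
      by_contra hb0
      refine hba (outcomes_ext fun i => ?_)
      by_cases hi : i ∈ IF ∧ x i = S.query i
      · rw [hp x b hb0 i (Finset.mem_univ _) hi.1 hi.2, h i (Finset.mem_univ _) hi.1 hi.2]
      · rw [(Finset.mem_filter.1 hb).2 i (by simpa [queried] using hi)]
    · simp
  · rw [zero_mul]
    by_contra h0
    exact h (hp x a (Ne.symm h0))

/-- The Local Friendliness behaviours are the sums of subnormalized tables satisfying Local Agency
in which the queried agents with a friend answer deterministically. -/
theorem mem_LF_iff (S : PublicScenario) (IF : Finset (Fin S.N)) (p : S.Table) :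
    p ∈ S.LF IF ↔ S.IsBehaviour p ∧ ∃ R : S.FriendOutcomes IF → S.Table,
      (∀ c x a, 0 ≤ R c x a) ∧ (∀ c, S.LocalAgency (R c)) ∧
      (∀ c x a, R c x a ≠ 0 → S.Consistent IF c Finset.univ x a) ∧
      ∀ x a, p x a = ∑ c, R c x a := by
  classical
  refine and_congr_right fun hp => ⟨?_, ?_⟩
  · rintro ⟨w, P, hw, -, hP, h⟩
    refine ⟨fun c x a => w c *
      (S.deltas IF x a c * S.marginal (P c) (Finset.univ \ S.queried IF x) x a), ?_, ?_, ?_, ?_⟩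
    · intro c x a
      refine mul_nonneg (hw c) (mul_nonneg ?_ (S.marginal_nonneg (fun x => ((hP c).1 x).1) _ _ _))
      rw [deltas_eq]
      split_ifs <;> simp
    · exact fun c => (S.deltas_mul_marginal_localAgency IF c (hP c).2).mul_left _
    · intro c x a h0
      by_contra hc
      simp [deltas_eq, hc] at h0
    · intro x a
      rw [h]
      exact Finset.sum_congr rfl fun c _ => mul_comm _ _
  · rintro ⟨R, hR, hLA, hC, h⟩
    let w : S.FriendOutcomes IF → ℝ := fun c => ∑ a, R c S.query a
    have hw : ∀ c x, ∑ a, R c x a = w c := fun c x => (hLA c).sum_eq x S.query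
    -- For `c` of weight zero any behaviour with Local Agency will do; the others are normalized.
    refine ⟨w, fun c => if w c = 0 then
      S.deterministic fun i s => ⟨0, zero_lt_two.trans_le (S.two_le_o i s)⟩ else
      fun x a => (w c)⁻¹ * R c x a, ?_, ?_, ?_, ?_⟩
    · exact fun c => Finset.sum_nonneg fun a _ => hR _ _ _
    · rw [← (hp S.query).2, Finset.sum_comm]
      exact Finset.sum_congr rfl fun a _ => (h _ a).symm
    · intro c
      dsimp only
      split_ifs with h0
      · exact ⟨S.deterministic_isBehaviour _, S.deterministic_localAgency _⟩
      · refine ⟨fun x => ⟨fun a => mul_nonneg (inv_nonneg.2 ?_) (hR _ _ _), ?_⟩,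
          (hLA c).mul_left _⟩
        · exact Finset.sum_nonneg fun a _ => hR _ _ _
        · rw [← Finset.mul_sum, hw, inv_mul_cancel₀ h0]
    · intro x a
      rw [h]
      refine Finset.sum_congr rfl fun c _ => ?_
      dsimp only
      split_ifs with h0
      · rw [h0, mul_zero]
        have := hw c x
        rw [h0, Finset.sum_eq_zero_iff_of_nonneg fun a _ => hR _ _ _] at this
        exact this a (Finset.mem_univ _)
      · rw [marginal_mul_left, ← S.deltas_mul_marginal_of_consistent IF c (hC c) x a]
        field_simp

/-! ### Finite hidden variable models, and the Bell set inside the Local Friendliness set -/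

/-- The measure is a weighted sum of Dirac masses. Its total mass is one because `p` is normalized.
-/
theorem mem_Bell_of_fintype {S : PublicScenario} {p : S.Table} (hp : S.IsBehaviour p)
    {Λ : Type} [Fintype Λ] (W : Λ → ℝ)
    (P : (i : Fin S.N) → (s : Fin (S.m i)) → Fin (S.o i s) → Λ → ℝ) (hW : ∀ l, 0 ≤ W l)
    (hP : ∀ i s l, (∀ k, 0 ≤ P i s k l) ∧ ∑ k, P i s k l = 1)
    (h : ∀ x a, p x a = ∑ l, W l * ∏ i, P i (x i) (a i) l) : p ∈ S.Bell := by
  let _ : MeasurableSpace Λ := ⊤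
  have hW1 : ∑ l, W l = 1 := by
    rw [← (hp S.query).2]
    simp only [h]
    rw [Finset.sum_comm]
    refine Finset.sum_congr rfl fun l _ => ?_
    rw [← Finset.mul_sum, ← Fintype.prod_sum fun i k => P i (S.query i) k l]
    simp [(hP _ _ _).2]
  refine ⟨hp, Λ, ⊤, ∑ l, ENNReal.ofReal (W l) • MeasureTheory.Measure.dirac l, P, ⟨?_⟩,
    fun i s k => measurable_from_top, hP, fun x a => ?_⟩
  · simp only [MeasureTheory.Measure.coe_finsetSum, Finset.sum_apply,
      MeasureTheory.Measure.smul_apply, MeasureTheory.measure_univ, smul_eq_mul, mul_one]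
    rw [← ENNReal.ofReal_sum_of_nonneg fun l _ => hW l, hW1, ENNReal.ofReal_one]
  · rw [h, MeasureTheory.integral_finsetSum_measure]
    · refine Finset.sum_congr rfl fun l _ => ?_
      rw [MeasureTheory.integral_smul_measure, MeasureTheory.integral_dirac,
        ENNReal.toReal_ofReal (hW l), smul_eq_mul]
    · intro l _
      exact (MeasureTheory.integrable_dirac (by simp)).smul_measure ENNReal.ofReal_ne_top

/-- A product of local distributions is a mixture of deterministic behaviours. -/
theorem prod_eq_sum_deterministic (S : PublicScenario)
    (P : (i : Fin S.N) → (s : Fin (S.m i)) → Fin (S.o i s) → ℝ)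
    (hP : ∀ i s, ∑ k, P i s k = 1) (x : S.Inputs) (a : S.Outcomes x) :
    ∏ i, P i (x i) (a i) = ∑ d : (i : Fin S.N) → (s : Fin (S.m i)) → Fin (S.o i s),
      (∏ i, ∏ s, P i s (d i s)) * S.deterministic d x a := by
  -- The indicator is spread over all pairs `(i, s)`, being trivial for `s ≠ x i`, so that the sum
  -- over `d` factorizes.
  have h1 : ∀ d : (i : Fin S.N) → (s : Fin (S.m i)) → Fin (S.o i s),
      (∏ i, ∏ s, P i s (d i s)) * S.deterministic d x a =
        ∏ i, ∏ s, P i s (d i s) * if s = x i → (d i s : ℕ) = a i then 1 else 0 := by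
    intro d
    have : ∀ i, (∏ s, if s = x i → (d i s : ℕ) = a i then (1 : ℝ) else 0) =
        if a i = d i (x i) then 1 else 0 := by
      intro i
      rw [Finset.prod_eq_single (x i)]
      · simp [Fin.ext_iff, eq_comm]
      · intro s _ hs
        simp [hs]
      · simp
    simp only [Finset.prod_mul_distrib, this]
    congr 1
    rw [Finset.prod_ite_zero, deterministic]
    simp
  simp only [h1]
  rw [← Fintype.prod_sum fun i (e : (s : Fin (S.m i)) → Fin (S.o i s)) =>
    ∏ s, P i s (e s) * if s = x i → (e s : ℕ) = a i then (1 : ℝ) else 0]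
  refine Finset.prod_congr rfl fun i _ => ?_
  rw [← Fintype.prod_sum fun s (k : Fin (S.o i s)) =>
    P i s k * if s = x i → (k : ℕ) = a i then (1 : ℝ) else 0, Finset.prod_eq_single (x i)]
  · rw [Finset.sum_eq_single (a i)]
    · simp
    · intro k _ hk
      simp [← Fin.ext_iff, hk]
    · simp
  · intro s _ hs
    simp [hs, hP]
  · simp

/-- Fine's argument: for each `l` draw the answers to all measurements independently, then average
over `l`. -/
theorem exists_deterministic_of_mem_Bell {S : PublicScenario} {p : S.Table} (hp : p ∈ S.Bell) :
    ∃ W : ((i : Fin S.N) → (s : Fin (S.m i)) → Fin (S.o i s)) → ℝ, (∀ d, 0 ≤ W d) ∧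
      ∀ x a, p x a = ∑ d, W d * S.deterministic d x a := by
  obtain ⟨-, Λ, mΛ, μ, P, hμ, hm, hP, h⟩ := hp
  refine ⟨fun d => ∫ l, ∏ i, ∏ s, P i s (d i s) l ∂μ, fun d => ?_, fun x a => ?_⟩
  · exact MeasureTheory.integral_nonneg fun l =>
      Finset.prod_nonneg fun i _ => Finset.prod_nonneg fun s _ => (hP i s l).1 _
  · rw [h]
    simp only [S.prod_eq_sum_deterministic (fun i s k => P i s k _) (fun i s => (hP i s _).2)]
    rw [MeasureTheory.integral_finsetSum]
    · simp only [MeasureTheory.integral_mul_const]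
    · intro d _
      refine MeasureTheory.Integrable.mul_const ?_ _
      refine MeasureTheory.Integrable.of_bound (C := 1) ?_ (.of_forall fun l => ?_)
      · exact (Finset.measurable_fun_prod _ fun i _ =>
          Finset.measurable_fun_prod _ fun s _ => hm i s _).aestronglyMeasurable
      · have h1 : ∀ i s k, P i s k l ≤ 1 := fun i s k =>
          (hP i s l).2 ▸ Finset.single_le_sum (f := fun k => P i s k l)
            (fun k _ => (hP i s l).1 k) (Finset.mem_univ k)
        have h2 : ∀ i, 0 ≤ ∏ s, P i s (d i s) l := fun i =>
          Finset.prod_nonneg fun s _ => (hP i s l).1 _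
        rw [Real.norm_of_nonneg (Finset.prod_nonneg fun i _ => h2 i)]
        exact Finset.prod_le_one (fun i _ => h2 i) fun i _ =>
          Finset.prod_le_one (fun s _ => (hP i s l).1 _) fun s _ => h1 _ _ _

/-- The deterministic strategies are grouped by their answers to the queries of the agents with
friends. -/
theorem Bell_subset_LF (S : PublicScenario) (IF : Finset (Fin S.N)) : S.Bell ⊆ S.LF IF := by
  intro p hp
  obtain ⟨W, hW, h⟩ := exists_deterministic_of_mem_Bell hp
  let D : S.FriendOutcomes IF →
      Finset ((i : Fin S.N) → (s : Fin (S.m i)) → Fin (S.o i s)) :=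
    fun c => {d | (fun i : {i // i ∈ IF} => d i (S.query i)) = c}
  refine (S.mem_LF_iff IF p).2 ⟨hp.1, fun c x a => ∑ d ∈ D c, W d * S.deterministic d x a,
    ?_, ?_, ?_, ?_⟩
  · exact fun c x a => Finset.sum_nonneg fun d _ =>
      mul_nonneg (hW d) (S.deterministic_nonneg d x a)
  · exact fun c => LocalAgency.sum fun d _ => (S.deterministic_localAgency d).mul_left _
  · intro c x a h0 i _ hi hx
    obtain ⟨d, hd, hd0⟩ := Finset.exists_ne_zero_of_sum_ne_zero h0
    have had : ∀ i, a i = d i (x i) := by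
      by_contra hc
      simp [deterministic, hc] at hd0
    rw [← (Finset.mem_filter.1 hd).2, had i, hx]
  · intro x a
    rw [h]
    exact (Finset.sum_fiberwise _ _ _).symm

/-! ### A box separating two Local Friendliness sets -/

/-- The outcome of agent `i` in a pair of perfectly correlated agents `i`, `j`, sharing the random
bit `t`. Agent `j` flips the bit if both she chooses `v` and agent `i` does not choose his query
measurement, unless she has a friend and chooses her query measurement, when she answers `0`. -/
def boxValue (S : PublicScenario) (IF : Finset (Fin S.N)) (i j : Fin S.N) (v : Fin (S.m j))
    (t : Bool) (x : S.Inputs) (k : Fin S.N) : ℕ :=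
  if k = i then t.toNat else if k = j then
    (if j ∈ IF ∧ x j = S.query j then 0 else
      (t ^^ (decide (x i ≠ S.query i) && decide (x j = v))).toNat)
  else 0

theorem boxValue_lt (S : PublicScenario) (IF : Finset (Fin S.N)) (i j : Fin S.N)
    (v : Fin (S.m j)) (t : Bool) (x : S.Inputs) (k : Fin S.N) :
    S.boxValue IF i j v t x k < S.o k (x k) := by
  refine lt_of_lt_of_le ?_ (S.two_le_o k (x k))
  unfold boxValue
  have := Bool.toNat_lt t
  have := Bool.toNat_lt (t ^^ (decide (x i ≠ S.query i) && decide (x j = v)))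
  split_ifs <;> omega

/-- The uniform mixture of the two values of the shared bit. -/
noncomputable def box (S : PublicScenario) (IF : Finset (Fin S.N)) (i j : Fin S.N)
    (v : Fin (S.m j)) : S.Table :=
  fun x a => ∑ t : Bool, if ∀ k, (a k : ℕ) = S.boxValue IF i j v t x k then 1 / 2 else 0

theorem marginal_box (S : PublicScenario) (IF : Finset (Fin S.N)) (i j : Fin S.N)
    (v : Fin (S.m j)) (V : Finset (Fin S.N)) (x : S.Inputs) (a : S.Outcomes x) :
    S.marginal (S.box IF i j v) V x a =
      ∑ t : Bool, if ∀ k ∈ V, (a k : ℕ) = S.boxValue IF i j v t x k then 1 / 2 else 0 := by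
  unfold box
  rw [marginal_sum]
  refine Finset.sum_congr rfl fun t _ => ?_
  have hv : ∀ k, (S.ofValues x (S.boxValue IF i j v t x) k : ℕ) = S.boxValue IF i j v t x k :=
    fun k => S.ofValues_val _ _ _ (S.boxValue_lt IF i j v t x k)
  have h : ∀ b : S.Outcomes x, (∀ k, (b k : ℕ) = S.boxValue IF i j v t x k) ↔
      b = S.ofValues x (S.boxValue IF i j v t x) := by
    intro b
    constructor
    · exact fun h => outcomes_ext fun k => by rw [h, hv]
    · rintro rfl
      exact hv
  simp only [marginal_eq_sum_ite, h]
  rw [Finset.sum_eq_single (S.ofValues x (S.boxValue IF i j v t x))]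
  · simp only [Fin.ext_iff, hv, if_true]
    exact if_congr (forall₂_congr fun k _ => eq_comm) rfl rfl
  · intro b _ hb
    simp [hb]
  · simp

theorem box_isBehaviour (S : PublicScenario) (IF : Finset (Fin S.N)) (i j : Fin S.N)
    (v : Fin (S.m j)) : S.IsBehaviour (S.box IF i j v) := by
  refine fun x => ⟨fun a => Finset.sum_nonneg fun t _ => by split_ifs <;> norm_num, ?_⟩
  have := S.marginal_box IF i j v ∅ x (S.ofValues x 0)
  simp only [marginal, Finset.notMem_empty, false_imp_iff, implies_true, Finset.filter_true,
    if_true, Fintype.sum_bool] at this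
  rw [this]
  norm_num

/-- Only a set `V` containing `j` but not `i` could detect a remote input, namely that of `i`. That
input merely flips the bit seen by `j`, and the bit is uniform. -/
theorem box_localAgency (S : PublicScenario) (IF : Finset (Fin S.N)) {i j : Fin S.N}
    (hij : i ≠ j) (v : Fin (S.m j)) : S.LocalAgency (S.box IF i j v) := by
  intro V x x' a a' h
  rw [marginal_box, marginal_box]
  by_cases hV : i ∉ V ∧ j ∈ V
  · let f : Bool := (decide (x i ≠ S.query i) && decide (x j = v)) ^^
      (decide (x' i ≠ S.query i) && decide (x' j = v))
    have hf : Function.Involutive fun t => t ^^ f := fun t => by simp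
    refine Fintype.sum_equiv hf.toPerm _ _ fun t => ?_
    refine if_congr (forall₂_congr fun k hk => ?_) rfl rfl
    have hki : k ≠ i := fun e => hV.1 (e ▸ hk)
    have hb : ∀ A B : Bool, ((t ^^ (A ^^ B)) ^^ B) = (t ^^ A) := by
      intro A B
      cases t <;> cases A <;> cases B <;> rfl
    rw [(h k hk).2]
    simp only [boxValue, hki, if_false, Function.Involutive.coe_toPerm, f, hb, (h j hV.2).1]
  · refine Finset.sum_congr rfl fun t _ => ?_
    refine if_congr (forall₂_congr fun k hk => ?_) rfl rfl
    rw [(h k hk).2]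
    unfold boxValue
    by_cases hk1 : k = i
    · simp [hk1]
    by_cases hk2 : k = j
    · subst hk2
      have hi : i ∈ V := by tauto
      rw [(h i hi).1, (h k hk).1]
    · simp [hk1, hk2]

/-- All weight sits on `c = 0`: the only random answer to a query could come from `i` or from a
friendless `j`. -/
theorem box_mem_LF (S : PublicScenario) {IF : Finset (Fin S.N)} {i j : Fin S.N}
    (hij : i ≠ j) (hi : i ∉ IF) (v : Fin (S.m j)) : S.box IF i j v ∈ S.LF IF := by
  classical
  let c₀ : S.FriendOutcomes IF := fun k => ⟨0, zero_lt_two.trans_le (S.two_le_o k _)⟩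
  refine (S.mem_LF_iff IF _).2 ⟨S.box_isBehaviour IF i j v,
    fun c x a => (if c = c₀ then 1 else 0) * S.box IF i j v x a, ?_, ?_, ?_, ?_⟩
  · exact fun c x a => mul_nonneg (by split_ifs <;> simp) ((S.box_isBehaviour IF i j v x).1 a)
  · exact fun c => (S.box_localAgency IF hij v).mul_left _
  · intro c x a h0 k _ hk hx
    have hc : c = c₀ := by
      by_contra hc
      simp [hc] at h0
    obtain ⟨t, -, ht⟩ := Finset.exists_ne_zero_of_sum_ne_zero (right_ne_zero_of_mul h0)
    have ha : ∀ k, (a k : ℕ) = S.boxValue IF i j v t x k := by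
      by_contra hc
      simp [hc] at ht
    have hki : k ≠ i := fun e => hi (e ▸ hk)
    rw [ha, hc]
    by_cases hkj : k = j
    · subst hkj
      simp [boxValue, hki, hk, hx, c₀]
    · simp [boxValue, hki, hkj, c₀]
  · simp

/-- Fix a `c` of positive weight. When `i` queries, `j` copies the predetermined answer of `i` on
both `u` and `v`, hence by Local Agency also when `i` does not query. There the box asks `i` to
agree with `j` on `u` and to disagree on `v`, while the possible answers of `i` cannot depend on the
input of `j`. -/
theorem box_notMem_LF (S : PublicScenario) {IF IF' : Finset (Fin S.N)} {i j : Fin S.N}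
    (hij : i ≠ j) (hi : i ∈ IF') {u v : Fin (S.m j)} (huv : u ≠ v)
    (hj : j ∈ IF → u ≠ S.query j ∧ v ≠ S.query j) : S.box IF i j v ∉ S.LF IF' := by
  intro hmem
  obtain ⟨hp, R, hR, hLA, hC, hsum⟩ := (S.mem_LF_iff IF' _).1 hmem
  have hne : ∀ k (s : Fin (S.m k)), ∃ s', s' ≠ s := fun k s =>
    haveI := Fin.nontrivial_iff_two_le.2 (S.two_le_m k)
    exists_ne s
  obtain ⟨q', hq'⟩ := hne i (S.query i)
  let X : Fin (S.m i) → Fin (S.m j) → S.Inputs := fun s r =>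
    Function.update (Function.update S.query i s) j r
  have Xi : ∀ s r, X s r i = s := fun s r => by simp [X, hij]
  have Xj : ∀ s r, X s r j = r := fun s r => by simp [X]
  have supp : ∀ c s r (a : S.Outcomes (X s r)), r = u ∨ r = v → R c (X s r) a ≠ 0 →
      ∃ t : Bool, (a i : ℕ) = t.toNat ∧
        (a j : ℕ) = (t ^^ (decide (s ≠ S.query i) && decide (r = v))).toNat := by
    intro c s r a hr h0
    have hb : S.box IF i j v (X s r) a ≠ 0 := by
      rw [hsum]
      exact (((hR c _ a).lt_of_ne' h0).trans_le (Finset.single_le_sum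
        (f := fun c => R c (X s r) a) (fun c _ => hR c _ a) (Finset.mem_univ c))).ne'
    obtain ⟨t, -, ht⟩ := Finset.exists_ne_zero_of_sum_ne_zero hb
    have ha : ∀ k, (a k : ℕ) = S.boxValue IF i j v t (X s r) k := by
      by_contra hc
      simp [hc] at ht
    have hjq : ¬ (j ∈ IF ∧ r = S.query j) := by
      rintro ⟨h1, rfl⟩
      rcases hr with h | h
      · exact (hj h1).1 h.symm
      · exact (hj h1).2 h.symm
    refine ⟨t, by simp [ha, boxValue], ?_⟩
    rw [ha]
    simp only [boxValue, Xi, Xj, hjq, hij.symm, if_false, if_true]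
  have h1 : ∑ a, S.box IF i j v (X q' v) a ≠ 0 := by simp [(hp _).2]
  obtain ⟨a, -, ha⟩ := Finset.exists_ne_zero_of_sum_ne_zero h1
  rw [hsum] at ha
  obtain ⟨c, -, ha⟩ := Finset.exists_ne_zero_of_sum_ne_zero ha
  have toI : ∀ s r r' (a : S.Outcomes (X s r)), R c (X s r) a ≠ 0 →
      ∃ a' : S.Outcomes (X s r'), R c (X s r') a' ≠ 0 ∧ (a' i : ℕ) = a i := by
    intro s r r' a h0
    obtain ⟨a', h1, h2⟩ := (hLA c).exists_ne_zero (hR c) {i} (X s r') (by simp [Xi]) h0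
    exact ⟨a', h1, h2 i (by simp)⟩
  have toJ : ∀ s s' r (a : S.Outcomes (X s r)), R c (X s r) a ≠ 0 →
      ∃ a' : S.Outcomes (X s' r), R c (X s' r) a' ≠ 0 ∧ (a' j : ℕ) = a j := by
    intro s s' r a h0
    obtain ⟨a', h1, h2⟩ := (hLA c).exists_ne_zero (hR c) {j} (X s' r) (by simp [Xj]) h0
    exact ⟨a', h1, h2 j (by simp)⟩
  -- From a possible outcome at `(q', v)`, two paths lead to a query by `i`: directly, keeping the
  -- answer of `j`, and through `(q', u)`, first keeping the answer of `i`. They force opposite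
  -- values of `c i`.
  obtain ⟨a₁, ha₁, e₁⟩ := toJ _ (S.query i) _ a ha
  obtain ⟨b, hb, e₂⟩ := toI _ _ u a ha
  obtain ⟨b₁, hb₁, e₃⟩ := toJ _ (S.query i) _ b hb
  have c₁ := hC c _ a₁ ha₁ i (Finset.mem_univ _) hi (Xi _ _)
  have c₂ := hC c _ b₁ hb₁ i (Finset.mem_univ _) hi (Xi _ _)
  obtain ⟨t, s₁, s₂⟩ := supp c _ _ a (.inr rfl) ha
  obtain ⟨t₁, s₃, s₄⟩ := supp c _ _ a₁ (.inr rfl) ha₁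
  obtain ⟨t₂, s₅, s₆⟩ := supp c _ _ b (.inl rfl) hb
  obtain ⟨t₃, s₇, s₈⟩ := supp c _ _ b₁ (.inl rfl) hb₁
  simp only [hq', huv, ne_eq, not_true_eq_false, not_false_eq_true, decide_true, decide_false,
    Bool.and_true, Bool.and_false, Bool.xor_false, Bool.xor_true] at s₂ s₄ s₆ s₈
  cases t <;> simp at s₁ s₂ <;> omega

/-! ### Local Friendliness inside the Bell set -/

/-- The input string in which every agent chooses the second measurement. -/
def second (S : PublicScenario) : S.Inputs := fun i => ⟨1, S.two_le_m i⟩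

/-- The outcome string `g` with the outcome of agent `j` replaced by the outcome `k` of
measurement `s`. -/
def replace (S : PublicScenario) (j : Fin S.N) (g : S.Outcomes S.second) (s : Fin (S.m j))
    (k : Fin (S.o j s)) : S.Outcomes (Function.update S.second j s) :=
  S.ofValues _ (Function.update (fun i => (g i : ℕ)) j k)

theorem replace_self (S : PublicScenario) (j : Fin S.N) (g : S.Outcomes S.second)
    (s : Fin (S.m j)) (k : Fin (S.o j s)) : (S.replace j g s k j : ℕ) = k := by
  rw [replace, ofValues_val] <;> simp

theorem replace_of_ne (S : PublicScenario) {i j : Fin S.N} (h : i ≠ j)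
    (g : S.Outcomes S.second) (s : Fin (S.m j)) (k : Fin (S.o j s)) :
    (S.replace j g s k i : ℕ) = g i := by
  rw [replace, ofValues_val] <;> simp [h]

/-- By Local Agency the marginal of the other agents ignores the measurement `s` of `j`; it will
normalize the conditional distribution of `j`. -/
theorem sum_replace (S : PublicScenario) {p : S.Table} (hp : S.LocalAgency p) (j : Fin S.N)
    (g : S.Outcomes S.second) (s : Fin (S.m j)) :
    ∑ k, p _ (S.replace j g s k) = S.marginal p (Finset.univ \ {j}) S.second g := by
  have h0 : 0 < S.o j s := zero_lt_two.trans_le (S.two_le_o j s)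
  rw [hp (Finset.univ \ {j}) S.second (Function.update S.second j s) g (S.replace j g s ⟨0, h0⟩),
    marginal]
  · refine Finset.sum_nbij' (fun k => S.replace j g s k)
      (fun b => Fin.cast (by rw [Function.update_self]) (b j)) ?_ ?_ ?_ ?_ ?_
    · intro k _
      simp only [Finset.mem_filter, Finset.mem_univ, true_and, Finset.mem_sdiff,
        Finset.mem_singleton]
      intro i hi
      exact Fin.ext (by rw [S.replace_of_ne hi, S.replace_of_ne hi])
    · simp
    · exact fun k _ => Fin.ext (by simp [replace_self])
    · intro b hb
      refine outcomes_ext fun i => ?_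
      by_cases hi : i = j
      · subst hi
        simp [replace_self]
      · rw [S.replace_of_ne hi, (Finset.mem_filter.1 hb).2 i (by simp [hi]), S.replace_of_ne hi]
    · exact fun _ _ => rfl
  · intro i hi
    have hij : i ≠ j := by simpa using hi
    exact ⟨by simp [hij], by rw [S.replace_of_ne hij]⟩

/-- If all agents but `j` have two measurements, the first of which has the predetermined outcome
`c i`, then a table satisfying Local Agency is determined by the inputs of `j`. -/
theorem eq_sum_replace (S : PublicScenario) {p : S.Table} (hp : S.LocalAgency p) {j : Fin S.N}
    (h : ∀ i, i ≠ j → S.m i = 2) (c : Fin S.N → ℕ)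
    (hc : ∀ x a, p x a ≠ 0 → ∀ i, i ≠ j → x i = S.query i → (a i : ℕ) = c i)
    (x : S.Inputs) (a : S.Outcomes x) :
    p x a = ∑ g : S.Outcomes S.second, if (g j : ℕ) = 0 ∧
      ∀ i, i ≠ j → (a i : ℕ) = if x i = S.query i then c i else (g i : ℕ)
      then p _ (S.replace j g (x j) (a j)) else 0 := by
  classical
  by_cases hC : ∀ i, i ≠ j → x i = S.query i → (a i : ℕ) = c i
  swap
  · rw [Finset.sum_eq_zero]
    · by_contra h0
      exact hC (hc x a h0)
    · intro g _
      refine if_neg fun hg => hC fun i hi hx => ?_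
      rw [hg.2 i hi, if_pos hx]
  -- Outside `V` the outcomes are forced by `c`. On `V` the inputs agree with `second`, except
  -- possibly at `j`, so Local Agency moves the marginal there.
  let V : Finset (Fin S.N) := {i | i = j ∨ x i ≠ S.query i}
  have h1 : p x a = S.marginal p V x a := by
    rw [marginal, Finset.sum_eq_single a]
    · intro b hb hba
      by_contra hb0
      refine hba (outcomes_ext fun i => ?_)
      by_cases hi : i = j ∨ x i ≠ S.query i
      · rw [(Finset.mem_filter.1 hb).2 i (by simpa [V] using hi)]
      · push Not at hi
        rw [hc x b hb0 i hi.1 hi.2, hC i hi.1 hi.2]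
    · simp
  let y := Function.update S.second j (x j)
  have hy : ∀ i ∈ V, x i = y i := by
    intro i hi
    by_cases hij : i = j
    · subst hij
      simp [y]
    · have hx : x i ≠ S.query i := by simpa [V, hij] using hi
      have hm := h i hij
      have := (x i).2
      have hx' : (x i : ℕ) ≠ 0 := fun e => hx (Fin.ext e)
      simp only [y, ne_eq, hij, not_false_eq_true, Function.update_of_ne]
      exact Fin.ext (show (x i : ℕ) = 1 by omega)
  have hv : ∀ i ∈ V, (S.ofValues y (fun i => (a i : ℕ)) i : ℕ) = a i :=
    fun i hi => S.ofValues_val_of_eq a i (hy i hi)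
  rw [h1, hp V x y a (S.ofValues y fun i => (a i : ℕ)) fun i hi => ⟨hy i hi, (hv i hi).symm⟩,
    marginal, ← Finset.sum_filter]
  have hz : ∀ b : S.Outcomes y, ∀ i,
      (S.ofValues S.second (Function.update (fun i => (b i : ℕ)) j 0) i : ℕ) =
        if i = j then 0 else (b i : ℕ) := by
    intro b i
    rw [ofValues_val]
    · simp [Function.update_apply]
    · by_cases hi : i = j
      · subst hi
        simpa using zero_lt_two.trans_le (S.two_le_o i _)
      · have : S.second i = y i := by simp [y, hi]
        rw [this]
        simp [hi]
  -- The coordinate `j` of `g` is a dummy, set to `0` so that each string of the other agents is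
  -- counted once.
  refine Finset.sum_nbij' (fun b => S.ofValues _ (Function.update (fun i => (b i : ℕ)) j 0))
    (fun g => S.replace j g (x j) (a j)) ?_ ?_ ?_ ?_ ?_
  · intro b hb
    refine Finset.mem_filter.2 ⟨Finset.mem_univ _, by simp [hz], fun i hi => ?_⟩
    split_ifs with hx
    · exact hC i hi hx
    · have hiV : i ∈ V := by simp [V, hx]
      rw [hz, if_neg hi, (Finset.mem_filter.1 hb).2 i hiV, hv i hiV]
  · intro g hg
    refine Finset.mem_filter.2 ⟨Finset.mem_univ _, fun i hiV => Fin.ext ?_⟩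
    rw [hv i hiV]
    by_cases hi : i = j
    · subst hi
      rw [replace_self]
    · have hx : x i ≠ S.query i := by simpa [V, hi] using hiV
      rw [S.replace_of_ne hi, (Finset.mem_filter.1 hg).2.2 i hi, if_neg hx]
  · intro b hb
    refine outcomes_ext fun i => ?_
    have hjV : j ∈ V := by simp [V]
    by_cases hi : i = j
    · subst hi
      rw [replace_self, (Finset.mem_filter.1 hb).2 i hjV, hv i hjV]
    · rw [S.replace_of_ne hi, hz, if_neg hi]
  · intro g hg
    refine outcomes_ext fun i => ?_
    rw [hz]
    split_ifs with hi
    · subst hi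
      exact (Finset.mem_filter.1 hg).2.1.symm
    · rw [S.replace_of_ne hi]
  · intro b hb
    congr 1
    refine outcomes_ext fun i => ?_
    have hjV : j ∈ V := by simp [V]
    by_cases hi : i = j
    · subst hi
      rw [replace_self, (Finset.mem_filter.1 hb).2 i hjV, hv i hjV]
    · rw [S.replace_of_ne hi, hz, if_neg hi]

theorem LF_subset_Bell (S : PublicScenario) {IF : Finset (Fin S.N)} {j : Fin S.N}
    (h : ∀ i, i ≠ j → i ∈ IF ∧ S.m i = 2) : S.LF IF ⊆ S.Bell := by
  classical
  intro p hmem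
  obtain ⟨hp, R, hR, hLA, hC, hsum⟩ := (S.mem_LF_iff IF p).1 hmem
  let C : S.FriendOutcomes IF → Fin S.N → ℕ := fun c i => if hi : i ∈ IF then c ⟨i, hi⟩ else 0
  let M : S.FriendOutcomes IF → S.Outcomes S.second → Fin S.N → ℝ :=
    fun c g i => S.marginal (R c) (Finset.univ \ {i}) S.second g
  have hM : ∀ c g i, 0 ≤ M c g i := fun c g i => S.marginal_nonneg (hR c) _ _ _
  -- The hidden variable is `(c, g)`, weighted by the marginal of the agents other than `j`, with
  -- the dummy `g j` fixed at `0`. Agent `j` answers with the conditional distribution, or with `0`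
  -- where the weight vanishes.
  refine mem_Bell_of_fintype hp (Λ := S.FriendOutcomes IF × S.Outcomes S.second)
    (fun l => if (l.2 j : ℕ) = 0 then M l.1 l.2 j else 0)
    (fun i s k l => if i = j then
      (if M l.1 l.2 i = 0 then (if (k : ℕ) = 0 then 1 else 0) else
        R l.1 _ (S.replace i l.2 s k) / M l.1 l.2 i) else
      if (k : ℕ) = if s = S.query i then C l.1 i else (l.2 i : ℕ) then 1 else 0) ?_ ?_ ?_
  · intro l
    split_ifs
    exacts [hM _ _ _, le_rfl]
  · rintro i s ⟨c, g⟩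
    have hone : ∀ n, n < S.o i s → ∑ k : Fin (S.o i s), (if (k : ℕ) = n then (1 : ℝ) else 0) = 1 := by
      intro n hn
      rw [Finset.sum_eq_single ⟨n, hn⟩]
      · simp
      · intro k _ hk
        simpa [Fin.ext_iff] using hk
      · simp
    dsimp only
    constructor
    · intro k
      split_ifs
      any_goals norm_num
      exact div_nonneg (hR _ _ _) (hM _ _ _)
    · by_cases hi : i = j
      · simp only [if_pos hi]
        by_cases h0 : M c g i = 0
        · simp only [if_pos h0]
          exact hone 0 (zero_lt_two.trans_le (S.two_le_o i s))
        · simp only [if_neg h0]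
          rw [← Finset.sum_div, S.sum_replace (hLA c), div_self h0]
      · simp only [if_neg hi]
        apply hone
        split_ifs with hs
        · subst hs
          simp [C, (h i hi).1]
        · have : s = S.second i := by
            have h1 := (h i hi).2
            have h2 := s.2
            have h3 : (s : ℕ) ≠ 0 := fun e => hs (Fin.ext e)
            exact Fin.ext (show (s : ℕ) = 1 by omega)
          rw [this]
          exact (g i).2
  · intro x a
    rw [hsum, Fintype.sum_prod_type]
    refine Finset.sum_congr rfl fun c _ => ?_
    rw [S.eq_sum_replace (hLA c) (fun i hi => (h i hi).2) (C c)]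
    · refine Finset.sum_congr rfl fun g _ => ?_
      rw [← Finset.mul_prod_erase _ _ (Finset.mem_univ j)]
      -- A vanishing weight kills every numerator, so the default answer of `j` is harmless.
      have h1 : ∀ k, M c g j = 0 → R c _ (S.replace j g (x j) k) = 0 := by
        intro k h0
        have := S.sum_replace (hLA c) j g (x j)
        change _ = M c g j at this
        rw [h0, Finset.sum_eq_zero_iff_of_nonneg fun _ _ => hR _ _ _] at this
        exact this k (Finset.mem_univ _)
      have h2 : (∏ i ∈ Finset.univ.erase j, if i = j then
          (if M c g i = 0 then (if (a i : ℕ) = 0 then 1 else 0) else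
            R c _ (S.replace i g (x i) (a i)) / M c g i) else
          if (a i : ℕ) = if x i = S.query i then C c i else (g i : ℕ) then (1 : ℝ) else 0) =
          if ∀ i, i ≠ j → (a i : ℕ) = if x i = S.query i then C c i else (g i : ℕ)
          then 1 else 0 := by
        rw [Finset.prod_congr rfl fun i hi => if_neg (Finset.ne_of_mem_erase hi),
          Finset.prod_ite_zero]
        simp
      simp only [h2, if_true]
      by_cases h0 : M c g j = 0
      · simp [h0, h1 _ h0]
      · simp only [h0, if_false, ite_and]
        split_ifs <;> simp [mul_div_cancel₀, h0]
    · intro x a h0 i hi hx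
      rw [hC c x a h0 i (Finset.mem_univ _) (h i hi).1 hx]
      simp [C, (h i hi).1]

/-! ### Consequences of an inclusion -/

theorem eq_two_of_LF_subset {S : PublicScenario} {IF IF' : Finset (Fin S.N)} {i : Fin S.N}
    (hi : i ∉ IF) (hi' : i ∈ IF') (h : S.LF IF ⊆ S.LF IF') (j : Fin S.N) (hj : j ≠ i) :
    j ∈ IF ∧ S.m j = 2 := by
  have hm := S.two_le_m j
  by_contra hc
  by_cases hjF : j ∈ IF
  · have h3 : 3 ≤ S.m j := by
      have : S.m j ≠ 2 := fun e => hc ⟨hjF, e⟩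
      omega
    -- The friend of `j` fixes her query, so the box uses two other measurements.
    refine S.box_notMem_LF (u := ⟨1, hm⟩) (v := ⟨2, h3⟩) hj.symm hi' ?_ ?_
      (h (S.box_mem_LF hj.symm hi _))
    · simp
    · simp [query]
  · refine S.box_notMem_LF (u := S.query j) (v := ⟨1, hm⟩) hj.symm hi' ?_ (fun e => (hjF e).elim)
      (h (S.box_mem_LF hj.symm hi _))
    simp [query]

theorem card_eq_of_forall_ne_mem {S : PublicScenario} {IF : Finset (Fin S.N)} {i : Fin S.N}
    (hi : i ∉ IF) (h : ∀ j, j ≠ i → j ∈ IF) : IF.card = S.N - 1 := by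
  have : IF = Finset.univ.erase i := by
    ext j
    simp only [Finset.mem_erase, Finset.mem_univ, and_true]
    exact ⟨fun hj e => hi (e ▸ hj), h j⟩
  rw [this, Finset.card_erase_of_mem (Finset.mem_univ i), Finset.card_univ, Fintype.card_fin]

end PublicScenario

theorem mainTheorem5 (S : PublicScenario) (IF IF' : Finset (Fin S.N))
    (h : ¬ IF ⊆ IF') (h' : ¬ IF' ⊆ IF) :
    ExactlyOne
      (IF.card = S.N - 1 ∧ IF'.card = S.N - 1 ∧ (∀ i, S.m i = 2) ∧
        S.LF IF = S.Bell ∧ S.LF IF' = S.Bell)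
      ((S.Bell = S.LF IF ∧ S.LF IF ⊂ S.LF IF') ∨ (S.Bell = S.LF IF' ∧ S.LF IF' ⊂ S.LF IF))
      (¬ S.LF IF ⊆ S.LF IF' ∧ ¬ S.LF IF' ⊆ S.LF IF) := by
  obtain ⟨i', hi', hi'F⟩ := Finset.not_subset.1 h
  obtain ⟨i, hiF, hi⟩ := Finset.not_subset.1 h'
  have e₁ : S.LF IF ⊆ S.LF IF' → S.LF IF = S.Bell := fun hs =>
    (S.LF_subset_Bell (PublicScenario.eq_two_of_LF_subset hi hiF hs)).antisymm
      (S.Bell_subset_LF IF)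
  have e₂ : S.LF IF' ⊆ S.LF IF → S.LF IF' = S.Bell := fun hs =>
    (S.LF_subset_Bell (PublicScenario.eq_two_of_LF_subset hi'F hi' hs)).antisymm
      (S.Bell_subset_LF IF')
  by_cases s₁ : S.LF IF ⊆ S.LF IF' <;> by_cases s₂ : S.LF IF' ⊆ S.LF IF
  · have t₁ := PublicScenario.eq_two_of_LF_subset hi hiF s₁
    have t₂ := PublicScenario.eq_two_of_LF_subset hi'F hi' s₂
    refine .inl ⟨⟨PublicScenario.card_eq_of_forall_ne_mem hi fun j hj => (t₁ j hj).1,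
      PublicScenario.card_eq_of_forall_ne_mem hi'F fun j hj => (t₂ j hj).1, fun j => ?_,
      e₁ s₁, e₂ s₂⟩, ?_, fun hn => hn.1 s₁⟩
    -- Each inclusion leaves out one agent, `i` or `i'`; these differ, so together they cover
    -- everyone.
    · by_cases hj : j = i
      · exact (t₂ j fun e => hi (hj ▸ e ▸ hi')).2
      · exact (t₁ j hj).2
    · rintro (hn | hn)
      · exact hn.2.2 s₂
      · exact hn.2.2 s₁
  · exact .inr (.inl ⟨fun hn => s₂ (hn.2.2.2.2.trans hn.2.2.2.1.symm).subset,
      .inl ⟨(e₁ s₁).symm, s₁, s₂⟩, fun hn => hn.1 s₁⟩)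
  · exact .inr (.inl ⟨fun hn => s₁ (hn.2.2.2.1.trans hn.2.2.2.2.symm).subset,
      .inr ⟨(e₂ s₂).symm, s₂, s₁⟩, fun hn => hn.2 s₂⟩)
  · refine .inr (.inr ⟨fun hn => s₁ (hn.2.2.2.1.trans hn.2.2.2.2.symm).subset, ?_, s₁, s₂⟩)
    rintro (hn | hn)
    · exact s₁ hn.2.1
    · exact s₂ hn.2.1
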